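/- Let $\mathbb K$ be a field, let $V=\mathbb K^n$ with $n\ge 0$, and let $\mathcal A$ be a central hyperplane arrangement in $V$, that is, a finite set of linear hyperplanes of $V$. Let $L(\mathcal A)$ be the set of all intersections of subfamilies of $\mathcal A$ (the empty intersection being $V$), ordered by reverse inclusion, and let $$\chi(\mathcal A,t)=\sum_{X\in L(\mathcal A)}\mu(X)\,t^{\dim X}$$ be the characteristic polynomial of $\mathcal A$, where $\mu(V)=1$ and $\mu(X)=-\sum_{Y<X}\mu(Y)$ for $X\ne V$. For $X\in L(\mathcal A)$ put $\mathcal A_X=\{H\in\mathcal A : X\subseteq H\}$. Let $\pi=\{\pi_1,\dots,\pi_\ell\}$ be a set partition of $\mathcal A$ into $\ell$ non-empty, pairwise disjoint parts. A tuple $(H_1,\dots,H_p)$ of hyperplanes of $\mathcal A$ (with $p\ge 0$) is a $p$-section of $\pi$ if $H_i$ and $H_j$ lie in different parts of $\pi$ whenever $i\ne j$. The partition $\pi$ is called nice if (1) $n-\dim\bigcap_{i=1}^p H_i=p$ for every $p\ge 0$ and every $p$-section $(H_1,\dots,H_p)$ of $\pi$, and (2) for every $X\in L(\mathcal A)$ with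 $X\neq V$ there is an $i\in\{1,\dots,\ell\}$ with $|\pi_i\cap\mathcal A_X|=1$. **Theorem.** The partition $\pi$ is nice if and only if, for every $X\in L(\mathcal A)$, $$\chi(\mathcal A_X,t)=t^{\,n-\ell}\prod_{i=1}^{\ell}\bigl(t-|\pi_i\cap\mathcal A_X|\bigr)$$ as an identity of Laurent polynomials in $\mathbb Z[t,t^{-1}]$. -/

import Mathlib

open scoped Classical LaurentPolynomial

/-- A central hyperplane arrangement in a vector space `V`: a finite set of linear hyperplanes,
that is, of maximal proper linear subspaces of `V`. -/
structure CentralArrangement (K : Type*) (V : Type*) [Field K] [AddCommGroup V] [Module K V] where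
  hyperplanes : Finset (Submodule K V)
  isCoatom_of_mem : ∀ H ∈ hyperplanes, IsCoatom H

namespace CentralArrangement

variable {K : Type*} {V : Type*} [Field K] [AddCommGroup V] [Module K V]

/-- The intersection poset `L(A)`: all intersections of (possibly empty) subfamilies of `A`; the
empty intersection is `V`. Its order is reverse inclusion, see the instance below. -/
def IntersectionPoset (A : CentralArrangement K V) : Type _ :=
  {X : Submodule K V // ∃ B : Finset (Submodule K V), B ⊆ A.hyperplanes ∧ X = B.inf id}

namespace IntersectionPoset

variable {A : CentralArrangement K V}

/-- The linear subspace underlying an element of `L(A)`. -/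
def toSubmodule (X : A.IntersectionPoset) : Submodule K V := X.1

/-- `X ≤ Y` in `L(A)` means `Y ⊆ X`. -/
instance : PartialOrder A.IntersectionPoset :=
  PartialOrder.lift (fun X => OrderDual.toDual X.toSubmodule)
    (fun _ _ h => Subtype.ext (OrderDual.toDual.injective h))

/-- The least element of `L(A)` is the whole space `V`. -/
instance : OrderBot A.IntersectionPoset where
  bot := ⟨⊤, ∅, Finset.empty_subset _, by simp⟩
  bot_le X := show X.toSubmodule ≤ ⊤ from le_top

instance : Finite A.IntersectionPoset :=
  Finite.of_surjective
    (fun B : A.hyperplanes.powerset =>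
      (⟨B.1.inf id, B.1, Finset.mem_powerset.1 B.2, rfl⟩ : A.IntersectionPoset))
    (fun ⟨_, B, hB, hX⟩ => ⟨⟨B, Finset.mem_powerset.2 hB⟩, Subtype.ext hX.symm⟩)

noncomputable instance : Fintype A.IntersectionPoset := Fintype.ofFinite _

noncomputable instance : LocallyFiniteOrder A.IntersectionPoset :=
  Fintype.toLocallyFiniteOrder

end IntersectionPoset

/-- The Möbius function `μ(X) = μ(V, X)` of `L(A)`: `μ(V) = 1` and `μ(X) = -∑_{Y < X} μ(Y)` for
`X ≠ V`. -/
noncomputable def moebius (A : CentralArrangement K V) (X : A.IntersectionPoset) : ℤ :=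
  IncidenceAlgebra.mu ℤ (⊥ : A.IntersectionPoset) X

/-- The characteristic polynomial `χ(A, t) = ∑_{X ∈ L(A)} μ(X) t ^ dim X`. -/
noncomputable def charPoly (A : CentralArrangement K V) : Polynomial ℤ :=
  ∑ X : A.IntersectionPoset,
    Polynomial.C (A.moebius X) * Polynomial.X ^ Module.finrank K X.toSubmodule

/-- The localization `A_X = {H ∈ A | X ⊆ H}`. -/
noncomputable def localization (A : CentralArrangement K V) (X : A.IntersectionPoset) :
    CentralArrangement K V where
  hyperplanes := A.hyperplanes.filter (fun H => X.toSubmodule ≤ H)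
  isCoatom_of_mem H hH := A.isCoatom_of_mem H (Finset.mem_filter.1 hH).1

/-- A `p`-section of a set partition `P` of `A`: a `p`-tuple of hyperplanes of `A` whose entries at
any two different positions lie in different parts of `P`. -/
def IsSection (A : CentralArrangement K V) (P : Finpartition A.hyperplanes) {p : ℕ}
    (S : Fin p → Submodule K V) : Prop :=
  (∀ i, S i ∈ A.hyperplanes) ∧ ∀ i j, i ≠ j → ∀ B ∈ P.parts, S i ∈ B → S j ∉ B

/-- A `p`-tuple of subspaces is independent if its intersection has codimension `p`, i.e.
`dim V - dim (⋂ i, S i) = p`. -/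
def IsIndependentTuple {p : ℕ} (S : Fin p → Submodule K V) : Prop :=
  Module.finrank K V - Module.finrank K (⨅ i, S i : Submodule K V) = p

/-- A set partition of `A` is independent if all its sections are independent. -/
def IsIndependentPartition (A : CentralArrangement K V) (P : Finpartition A.hyperplanes) : Prop :=
  ∀ (p : ℕ) (S : Fin p → Submodule K V), A.IsSection P S → IsIndependentTuple S

/-- A set partition of `A` is nice if it is independent and for every `X ∈ L(A)` with `X ≠ V` some
part meets `A_X` in exactly one hyperplane. -/
def IsNice (A : CentralArrangement K V) (P : Finpartition A.hyperplanes) : Prop :=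
  A.IsIndependentPartition P ∧
    ∀ X : A.IntersectionPoset, X ≠ ⊥ →
      ∃ B ∈ P.parts, (B ∩ (A.localization X).hyperplanes).card = 1

end CentralArrangement

/-!
Consider the sections `s` of the partition `P` up to reordering, that is, the sets of hyperplanes
with at most one member in each part. Write `|s|` for the number of hyperplanes in `s` and `⋂ s`
for their intersection. Expanding the product for `X`, where each part contributes either `t` or
minus one of its hyperplanes that contain `X`, gives (`prod_sub_card_eq_sum_sections`)
`t ^ (n - ℓ) * ∏ (t - |B ∩ A_X|) = ∑ (-1) ^ |s| * t ^ (n - |s|)`,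
the sum over the sections `s` with `X ⊆ ⋂ s`. On the other side, `L(A_X)` is the interval `[V, X]`
of `L(A)`, so that `χ(A_X, t) = ∑_{Y ≤ X} μ(Y) t ^ dim Y` (`toLaurent_charPoly_localization`).
By Möbius inversion (`eq_of_sum_Icc_bot_eq`) the factorization holds for all `X` if and only if, for
all `Y`,
`μ(Y) t ^ dim Y = ∑_{⋂ s = Y} (-1) ^ |s| * t ^ (n - |s|)`.

At `t = 1` the latter says `μ(Y) = ∑_{⋂ s = Y} (-1) ^ |s|` for all `Y`. Summed over `[V, X]`, this
says `∏ (1 - |B ∩ A_X|) = 0` for all `X ≠ V`, which is the second condition for `P` to be nice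
(`forall_exists_card_eq_one_iff`). Moreover, terms with the same power of `t` on the right have the
same sign and cannot cancel, so the identity also forces `n - |s| = dim Y` for each section `s` with
`⋂ s = Y`, which is independence. Conversely, independence turns the identity at `t = 1` back into
the identity in `t`.
-/
namespace CentralArrangement

/-! ### Möbius functions and characteristic polynomials of localizations -/

section Localization

variable {K V : Type*} [Field K] [AddCommGroup V] [Module K V] {A : CentralArrangement K V}

lemma IntersectionPoset.le_iff {X Y : A.IntersectionPoset} :
    X ≤ Y ↔ Y.toSubmodule ≤ X.toSubmodule := Iff.rfl

lemma IntersectionPoset.toSubmodule_injective :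
    Function.Injective (toSubmodule : A.IntersectionPoset → Submodule K V) :=
  Subtype.val_injective

/-- An intersection of members of the localization `A_X`, seen as an element of `L(A)`. -/
def IntersectionPoset.ofLocalization (X : A.IntersectionPoset)
    (Y : (A.localization X).IntersectionPoset) : A.IntersectionPoset :=
  ⟨Y.1, Y.2.imp fun _ h => ⟨h.1.trans (Finset.filter_subset _ _), h.2⟩⟩

lemma IntersectionPoset.ofLocalization_injective (X : A.IntersectionPoset) :
    Function.Injective (ofLocalization X) := fun _ _ h =>
  Subtype.ext (congrArg (toSubmodule (A := A)) h)

/-- `L(A_X)` is the interval `[V, X]` of `L(A)`. -/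
lemma IntersectionPoset.exists_ofLocalization_eq {X Y : A.IntersectionPoset} :
    (∃ Z, ofLocalization X Z = Y) ↔ Y ≤ X := by
  constructor
  · rintro ⟨⟨_, B, hB, rfl⟩, rfl⟩
    exact Finset.le_inf fun H hH => (Finset.mem_filter.1 (hB hH)).2
  · obtain ⟨_, B, hB, rfl⟩ := Y
    intro h
    refine ⟨⟨B.inf id, B, fun H hH => Finset.mem_filter.2 ⟨hB hH, ?_⟩, rfl⟩, rfl⟩
    exact (le_iff.1 h).trans (Finset.inf_le (f := id) hH)

lemma IntersectionPoset.map_ofLocalization_Icc (X : A.IntersectionPoset)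
    (Y : (A.localization X).IntersectionPoset) :
    (Finset.Icc ⊥ Y).map ⟨_, ofLocalization_injective X⟩ = Finset.Icc ⊥ (ofLocalization X Y) := by
  ext Z
  simp only [Finset.mem_map, Finset.mem_Icc, bot_le, true_and, Function.Embedding.coeFn_mk]
  constructor
  · rintro ⟨W, hW, rfl⟩
    exact hW
  · intro h
    have hY := exists_ofLocalization_eq.1 ⟨Y, rfl⟩
    obtain ⟨W, rfl⟩ := exists_ofLocalization_eq.2 (h.trans hY)
    exact ⟨W, h, rfl⟩

/-- Möbius inversion on `L(A)`: a function is determined by its sums over the intervals `[V, X]`. -/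
lemma eq_of_sum_Icc_bot_eq {M : Type*} [AddCommGroup M] {f g : A.IntersectionPoset → M}
    (h : ∀ X, ∑ Y ∈ Finset.Icc ⊥ X, f Y = ∑ Y ∈ Finset.Icc ⊥ X, g Y) : f = g := by
  funext X
  induction X using WellFoundedLT.induction with
  | ind X ih =>
    have hX := h X
    rw [← Finset.Ico_insert_right bot_le, Finset.sum_insert Finset.right_notMem_Ico,
      Finset.sum_insert Finset.right_notMem_Ico,
      Finset.sum_congr rfl fun Y hY => ih Y (Finset.mem_Ico.1 hY).2] at hX
    exact add_right_cancel hX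

lemma moebius_localization (X : A.IntersectionPoset) (Y : (A.localization X).IntersectionPoset) :
    (A.localization X).moebius Y = A.moebius (IntersectionPoset.ofLocalization X Y) := by
  have key : (A.localization X).moebius =
      fun Y => A.moebius (IntersectionPoset.ofLocalization X Y) := by
    refine eq_of_sum_Icc_bot_eq fun Z => ?_
    have h := IncidenceAlgebra.sum_Icc_mu_right (𝕜 := ℤ) ⊥ (IntersectionPoset.ofLocalization X Z)
    rw [← IntersectionPoset.map_ofLocalization_Icc, Finset.sum_map] at h
    refine (IncidenceAlgebra.sum_Icc_mu_right ⊥ Z).trans (.trans ?_ h.symm)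
    exact if_congr (IntersectionPoset.ofLocalization_injective X).eq_iff.symm rfl rfl
  exact congrFun key Y

lemma toLaurent_charPoly_localization (X : A.IntersectionPoset) :
    Polynomial.toLaurent (A.localization X).charPoly =
      ∑ Y ∈ Finset.Icc ⊥ X, (LaurentPolynomial.C (A.moebius Y) *
        LaurentPolynomial.T (Module.finrank K Y.toSubmodule) : ℤ[T;T⁻¹]) := by
  have h : Finset.Icc ⊥ X = Finset.univ.map ⟨_, IntersectionPoset.ofLocalization_injective X⟩ := by
    ext Y
    simp [IntersectionPoset.exists_ofLocalization_eq]
  rw [h, Finset.sum_map, charPoly, map_sum]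
  simp only [Polynomial.toLaurent_C_mul_X_pow, moebius_localization]
  rfl

end Localization

/-! ### Sections of a partition -/

section Sections

variable {K V : Type*} [Field K] [AddCommGroup V] [Module K V] {A : CentralArrangement K V}
  (P : Finpartition A.hyperplanes)

/-- The sections of a partition `P`, up to reordering: partial functions choosing from each part at
most one of its hyperplanes, `none` standing for no choice. -/
noncomputable def sections : Finset (P.parts → Option (Submodule K V)) :=
  Fintype.piFinset fun B => B.1.insertNone

variable {P}

lemma mem_sections {s : P.parts → Option (Submodule K V)} :
    s ∈ sections P ↔ ∀ B, ∀ H ∈ s B, H ∈ B.1 := by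
  simp [sections, Finset.mem_insertNone]

/-- The number of hyperplanes in a section. -/
noncomputable def sectionCard (s : P.parts → Option (Submodule K V)) : ℕ :=
  (Finset.univ.filter fun B => (s B).isSome).card

/-- The intersection of the hyperplanes in a section. -/
def sectionInf (s : P.parts → Option (Submodule K V)) : Submodule K V :=
  ⨅ B, (s B).elim ⊤ id

lemma exists_toSubmodule_eq_sectionInf {s : P.parts → Option (Submodule K V)}
    (hs : s ∈ sections P) : ∃ X : A.IntersectionPoset, X.toSubmodule = sectionInf s := by
  refine ⟨⟨sectionInf s, Finset.univ.biUnion fun B => (s B).toFinset, ?_, ?_⟩, rfl⟩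
  · intro H hH
    obtain ⟨B, -, hB⟩ := Finset.mem_biUnion.1 hH
    exact P.subset B.2 (mem_sections.1 hs B H (Option.mem_toFinset.1 hB))
  · rw [Finset.inf_biUnion, Finset.inf_univ_eq_iInf]
    refine iInf_congr fun B => ?_
    cases s B <;> simp

lemma sum_sections_le_sectionInf {M : Type*} [AddCommMonoid M]
    (f : (P.parts → Option (Submodule K V)) → M) (X : A.IntersectionPoset) :
    ∑ s ∈ sections P with X.toSubmodule ≤ sectionInf s, f s =
      ∑ Y ∈ Finset.Icc ⊥ X, ∑ s ∈ sections P with sectionInf s = Y.toSubmodule, f s := by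
  simp_rw [Finset.sum_filter]
  rw [Finset.sum_comm]
  refine Finset.sum_congr rfl fun s hs => ?_
  obtain ⟨Y, hY⟩ := exists_toSubmodule_eq_sectionInf hs
  simp [← hY, IntersectionPoset.toSubmodule_injective.eq_iff, IntersectionPoset.le_iff]

/-- Expanding the product chooses from each part either the factor `a` or a hyperplane containing
`X`, that is, a section whose intersection contains `X`. -/
lemma prod_sub_card_eq_sum_sections {R : Type*} [CommRing R] (a : R) (X : A.IntersectionPoset) :
    ∏ B ∈ P.parts, (a - ((B ∩ (A.localization X).hyperplanes).card : R)) =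
      ∑ s ∈ sections P with X.toSubmodule ≤ sectionInf s,
        (-1) ^ sectionCard s * a ^ (P.parts.card - sectionCard s) := by
  have hfac : ∀ B ∈ P.parts, a - ((B ∩ (A.localization X).hyperplanes).card : R) =
      ∑ o ∈ (B.filter fun H => X.toSubmodule ≤ H).insertNone, o.elim a fun _ => (-1 : R) := by
    intro B hB
    have : B ∩ (A.localization X).hyperplanes = B.filter fun H => X.toSubmodule ≤ H := by
      ext H
      simp only [localization, Finset.mem_inter, Finset.mem_filter]
      exact ⟨fun h => ⟨h.1, h.2.2⟩, fun h => ⟨h.1, P.subset hB h.1, h.2⟩⟩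
    rw [this, Finset.sum_insertNone]
    simp [sub_eq_add_neg]
  rw [Finset.prod_congr rfl hfac, ← Finset.prod_coe_sort, Finset.prod_univ_sum]
  refine Finset.sum_congr ?_ fun s _ => ?_
  · ext s
    simp only [Fintype.mem_piFinset, Finset.mem_insertNone, Finset.mem_filter, mem_sections,
      sectionInf, le_iInf_iff]
    rw [← forall_and]
    refine forall_congr' fun B => ?_
    cases s B <;> simp
  · have h (B : P.parts) : (s B).elim a (fun _ => (-1 : R)) = if (s B).isSome then -1 else a := by
      cases s B <;> simp
    have hcard := Finset.card_filter_add_card_filter_not (s := Finset.univ)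
      fun B : P.parts => (s B).isSome
    rw [Finset.card_univ, Fintype.card_coe] at hcard
    simp_rw [h]
    rw [Finset.prod_ite, Finset.prod_const, Finset.prod_const, ← hcard, sectionCard,
      Nat.add_sub_cancel_left]

lemma sectionCard_le (s : P.parts → Option (Submodule K V)) : sectionCard s ≤ P.parts.card :=
  (Finset.card_le_univ _).trans_eq (Fintype.card_coe _)

/-- The function-valued sections and the tuple-valued ones are the same up to reordering. -/
lemma exists_isSection_of_mem_sections {s : P.parts → Option (Submodule K V)}
    (hs : s ∈ sections P) :
    ∃ S : Fin (sectionCard s) → Submodule K V, A.IsSection P S ∧ ⨅ i, S i = sectionInf s := by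
  let e := (Finset.univ.filter fun B : P.parts => (s B).isSome).equivFin.symm
  have hsome (i) : (s (e i)).isSome := (Finset.mem_filter.1 (e i).2).2
  have hmem (i) : (s (e i)).get (hsome i) ∈ (e i).1.1 :=
    mem_sections.1 hs _ _ (Option.get_mem _)
  refine ⟨fun i => (s (e i)).get (hsome i), ⟨fun i => P.subset (e i).1.2 (hmem i), ?_⟩, ?_⟩
  · intro i j hij B hB hi hj
    refine hij (e.injective (Subtype.ext (Subtype.ext ?_)))
    rw [P.eq_of_mem_parts (e i).1.2 hB (hmem i) hi, P.eq_of_mem_parts (e j).1.2 hB (hmem j) hj]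
  · refine le_antisymm (le_iInf fun B => ?_) (le_iInf fun i => ?_)
    · cases h : s B with
      | none => exact le_top
      | some H =>
        have hB : (s B).isSome := by simp [h]
        obtain ⟨i, hi⟩ := e.surjective ⟨B, Finset.mem_filter.2 ⟨Finset.mem_univ _, hB⟩⟩
        have hi' : (e i).1 = B := congrArg Subtype.val hi
        refine (iInf_le _ i).trans_eq (Option.some_injective _ ?_)
        rw [Option.some_get, hi', h]
        rfl
    · refine (iInf_le _ (e i).1).trans_eq ?_
      conv_lhs => rw [← Option.some_get (hsome i)]
      rfl

lemma IsSection.exists_mem_sections {p : ℕ} {S : Fin p → Submodule K V} (hS : A.IsSection P S) :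
    ∃ s ∈ sections P, sectionCard s = p ∧ sectionInf s = ⨅ i, S i := by
  choose f hf using fun i => P.exists_mem (hS.1 i)
  let g : Fin p → P.parts := fun i => ⟨f i, (hf i).1⟩
  have hg : Function.Injective g := fun i j hij => by
    by_contra hne
    have : f i = f j := congrArg Subtype.val hij
    exact hS.2 i j hne (f i) (hf i).1 (hf i).2 (this ▸ (hf j).2)
  have hout {B} (hB : ¬∃ i, g i = B) :
      Function.extend g (fun i => some (S i)) (fun _ => none) B = none :=
    Function.extend_apply' _ _ _ hB
  refine ⟨Function.extend g (fun i => some (S i)) fun _ => none, mem_sections.2 ?_, ?_, ?_⟩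
  · intro B H hH
    by_cases hB : ∃ i, g i = B
    · obtain ⟨i, rfl⟩ := hB
      rw [hg.extend_apply, Option.mem_some_iff] at hH
      exact hH ▸ (hf i).2
    · simp [hout hB] at hH
  · rw [sectionCard]
    have : (Finset.univ.filter fun B => (Function.extend g (fun i => some (S i))
        (fun _ => none) B).isSome) = Finset.univ.image g := by
      ext B
      by_cases hB : ∃ i, g i = B
      · obtain ⟨i, rfl⟩ := hB
        simp [hg.extend_apply]
      · simp [hout hB] at hB ⊢
        exact hB
    rw [this, Finset.card_image_of_injective _ hg, Finset.card_univ, Fintype.card_fin]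
  · refine le_antisymm (le_iInf fun i => ?_) (le_iInf fun B => ?_)
    · refine (iInf_le _ (g i)).trans_eq ?_
      rw [hg.extend_apply]
      rfl
    · by_cases hB : ∃ i, g i = B
      · obtain ⟨i, rfl⟩ := hB
        rw [hg.extend_apply]
        exact iInf_le _ i
      · rw [hout hB]
        exact le_top

lemma isIndependentPartition_iff [FiniteDimensional K V] :
    A.IsIndependentPartition P ↔ ∀ s ∈ sections P,
      Module.finrank K (sectionInf s) + sectionCard s = Module.finrank K V := by
  constructor
  · intro h s hs
    obtain ⟨S, hS, hinf⟩ := exists_isSection_of_mem_sections hs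
    have := h _ S hS
    rw [IsIndependentTuple, hinf] at this
    have := (sectionInf s).finrank_le
    omega
  · intro h p S hS
    obtain ⟨s, hs, hp, hinf⟩ := hS.exists_mem_sections
    have := h s hs
    rw [IsIndependentTuple, ← hinf]
    omega

/-- The condition on single hyperplanes in the definition of a nice partition says that the section
count `∑ (-1) ^ |s|` over all sections with a given intersection is the Möbius function, because
its sums over the intervals `[V, X]` are the products `∏ (1 - |B ∩ A_X|)`. -/
lemma forall_exists_card_eq_one_iff :
    (∀ X : A.IntersectionPoset, X ≠ ⊥ →
        ∃ B ∈ P.parts, (B ∩ (A.localization X).hyperplanes).card = 1) ↔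
      ∀ Y : A.IntersectionPoset, A.moebius Y =
        ∑ s ∈ sections P with sectionInf s = Y.toSubmodule, (-1) ^ sectionCard s := by
  have hprod (X : A.IntersectionPoset) :
      ∏ B ∈ P.parts, (1 - ((B ∩ (A.localization X).hyperplanes).card : ℤ)) =
        ∑ Y ∈ Finset.Icc ⊥ X,
          ∑ s ∈ sections P with sectionInf s = Y.toSubmodule, (-1) ^ sectionCard s := by
    rw [prod_sub_card_eq_sum_sections, ← sum_sections_le_sectionInf]
    simp
  have hmu (X : A.IntersectionPoset) :
      ∑ Y ∈ Finset.Icc ⊥ X, A.moebius Y = if ⊥ = X then 1 else 0 :=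
    IncidenceAlgebra.sum_Icc_mu_right ⊥ X
  constructor
  · intro h
    refine congrFun (eq_of_sum_Icc_bot_eq fun X => ?_)
    rw [hmu, ← hprod]
    split_ifs with hX
    · subst hX
      refine (Finset.prod_eq_one fun B hB => ?_).symm
      -- No hyperplane contains `V`.
      have : B ∩ (A.localization ⊥).hyperplanes = ∅ := by
        refine Finset.eq_empty_of_forall_notMem fun H hH => ?_
        obtain ⟨hH, hle⟩ := Finset.mem_filter.1 (Finset.mem_inter.1 hH).2
        exact (A.isCoatom_of_mem H hH).1 (top_le_iff.1 hle)
      simp [this]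
    · obtain ⟨B, hB, h1⟩ := h X (Ne.symm hX)
      exact (Finset.prod_eq_zero hB (by simp [h1])).symm
  · intro h X hX
    have h0 := hmu X
    simp_rw [h] at h0
    rw [← hprod, if_neg hX.symm, Finset.prod_eq_zero_iff] at h0
    obtain ⟨B, hB, h1⟩ := h0
    exact ⟨B, hB, by omega⟩

end Sections

end CentralArrangement

/-! ### Nice partitions and factorization -/

open CentralArrangement in
theorem theorem1p3 {K : Type*} [Field K] (n : ℕ) (A : CentralArrangement K (Fin n → K))
    (P : Finpartition A.hyperplanes) :
    A.IsNice P ↔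
      ∀ X : A.IntersectionPoset,
        (Polynomial.toLaurent (A.localization X).charPoly : ℤ[T;T⁻¹]) =
          LaurentPolynomial.T ((n : ℤ) - (P.parts.card : ℤ)) *
            ∏ B ∈ P.parts,
              (LaurentPolynomial.T 1 -
                LaurentPolynomial.C ((B ∩ (A.localization X).hyperplanes).card : ℤ)) := by
  have hprod (X : A.IntersectionPoset) :
      LaurentPolynomial.T ((n : ℤ) - (P.parts.card : ℤ)) * ∏ B ∈ P.parts,
        (LaurentPolynomial.T 1 -
          LaurentPolynomial.C ((B ∩ (A.localization X).hyperplanes).card : ℤ)) =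
      ∑ Y ∈ Finset.Icc ⊥ X, ∑ s ∈ sections P with sectionInf s = Y.toSubmodule,
        (LaurentPolynomial.C ((-1) ^ sectionCard s) *
          LaurentPolynomial.T ((n : ℤ) - sectionCard s) : ℤ[T;T⁻¹]) := by
    have h := prod_sub_card_eq_sum_sections (P := P) (LaurentPolynomial.T 1 : ℤ[T;T⁻¹]) X
    simp only [map_natCast]
    rw [h, ← sum_sections_le_sectionInf, Finset.mul_sum]
    refine Finset.sum_congr rfl fun s _ => ?_
    rw [mul_left_comm, LaurentPolynomial.T_pow, ← LaurentPolynomial.T_add, map_pow, map_neg,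
      map_one, mul_one, Nat.cast_sub (sectionCard_le s)]
    congr 2
    ring
  have hinv : (∀ X : A.IntersectionPoset,
      (Polynomial.toLaurent (A.localization X).charPoly : ℤ[T;T⁻¹]) =
        LaurentPolynomial.T ((n : ℤ) - (P.parts.card : ℤ)) * ∏ B ∈ P.parts,
          (LaurentPolynomial.T 1 -
            LaurentPolynomial.C ((B ∩ (A.localization X).hyperplanes).card : ℤ))) ↔
      ∀ Y : A.IntersectionPoset,
        (LaurentPolynomial.C (A.moebius Y) *
          LaurentPolynomial.T (Module.finrank K Y.toSubmodule) : ℤ[T;T⁻¹]) =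
        ∑ s ∈ sections P with sectionInf s = Y.toSubmodule,
          (LaurentPolynomial.C ((-1) ^ sectionCard s) *
            LaurentPolynomial.T ((n : ℤ) - sectionCard s)) := by
    simp_rw [hprod, toLaurent_charPoly_localization]
    exact ⟨fun h => congrFun (eq_of_sum_Icc_bot_eq h),
      fun h X => Finset.sum_congr rfl fun Y _ => h Y⟩
  rw [hinv, IsNice, isIndependentPartition_iff, forall_exists_card_eq_one_iff,
    Module.finrank_fin_fun]
  constructor
  · rintro ⟨hind, hmu⟩ Y
    rw [hmu Y, map_sum, Finset.sum_mul]
    refine Finset.sum_congr rfl fun s hs => ?_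
    obtain ⟨hs, hY⟩ := Finset.mem_filter.1 hs
    have := hind s hs
    rw [← hY]
    congr 2
    omega
  · intro h
    constructor
    · intro s₀ hs₀
      by_contra hne
      obtain ⟨Y, hY⟩ := exists_toSubmodule_eq_sectionInf hs₀
      -- All sections contributing to the coefficient of `t ^ (n - |s₀|)` have the same sign, so it
      -- is nonzero on the right hand side, whereas `dim Y` is the only exponent on the left.
      have hc := congrArg (fun f : ℤ[T;T⁻¹] => f.coeff ((n : ℤ) - sectionCard s₀)) (h Y)
      have hdim : (Module.finrank K Y.toSubmodule : ℤ) ≠ (n : ℤ) - sectionCard s₀ := by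
        rw [hY]
        omega
      simp only [← LaurentPolynomial.single_eq_C_mul_T, AddMonoidAlgebra.coeff_sum,
        AddMonoidAlgebra.coeff_single, Finsupp.finsetSum_apply, Finsupp.single_apply,
        if_neg hdim, sub_right_inj, Nat.cast_inj] at hc
      rw [← Finset.sum_filter, Finset.sum_congr rfl fun s hs => by
        rw [(Finset.mem_filter.1 hs).2], Finset.sum_const, nsmul_eq_mul] at hc
      have hpos : 0 < ({s ∈ {s ∈ sections P | sectionInf s = Y.toSubmodule} |
          sectionCard s = sectionCard s₀} : Finset _).card :=
        Finset.card_pos.2 ⟨s₀, by simp [hs₀, hY]⟩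
      exact mul_ne_zero (Nat.cast_ne_zero.2 hpos.ne') (pow_ne_zero _ (by simp)) hc.symm
    · intro Y
      -- Evaluate at `t = 1`.
      have := congrArg (LaurentPolynomial.eval₂ (RingHom.id ℤ) 1) (h Y)
      simpa [LaurentPolynomial.eval₂_C, LaurentPolynomial.eval₂_T] using this
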